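/- Every irrational $x\in(0,1)$ has a unique infinite regular continued fraction expansion $x=1/(a_1(x)+1/(a_2(x)+\cdots))$ with positive integer digits $a_i(x)$; let $q_n(x)$ denote the denominator of its $n$-th convergent, that is, $q_{-1}=0$, $q_0=1$, $q_n=a_nq_{n-1}+q_{n-2}$ for $n\ge 1$. For $\alpha\in\mathbb{R}$ let \[ \mathcal{F}_\alpha:=\Bigl\{x\in(0,1)\setminus\mathbb{Q}:\ \lim_{n\to\infty}\frac{\log\prod_{i=1}^n a_i(x)}{\log q_n(x)}=\alpha\Bigr\},\qquad f(\alpha):=\dim_H(\mathcal{F}_\alpha), \] where $\dim_H$ is the Hausdorff dimension. Theorem. As $\alpha\nearrow 1$, \[ f(\alpha)=\frac12+\Theta\left(\frac{\log\log(1/(1-\alpha))}{\log(1/(1-\alpha))}\right), \] that is, there are constants $0<c_1\le c_2$ such that \[ c_1\,\frac{\log\log(1/(1-\alpha))}{\log(1/(1-\alpha))}\ \le\ f(\alpha)-\frac12\ \le\ c_2\,\frac{\log\log(1/(1-\alpha))}{\log(1/(1-\alpha))} \] for all $\alpha<1$ sufficiently close to $1$. Moreover, for any constants $0<c_1<1$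 and $c_2>2$ these inequalities hold for all $\alpha<1$ sufficiently close to $1$ (how close may depend on $c_1$ and $c_2$). -/

import Mathlib

open Filter Topology

noncomputable section

/-- The set of irrational numbers of the open unit interval. -/
def unitIrrationals : Set ℝ := {x | x ∈ Set.Ioo (0 : ℝ) 1 ∧ Irrational x}

/-- The digit `a_{i+1}(x)` of the regular continued fraction expansion
`x = 1/(a₁ + 1/(a₂ + ⋯))` of `x ∈ (0,1)`, as a real number; numbering starts at `i = 0`.
For irrational `x` the expansion is infinite, so that the default value `1` is never used. -/
def cfDigit (x : ℝ) (i : ℕ) : ℝ := ((GenContFract.of x).partDens.get? i).getD 1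

/-- The denominator `q_n(x)` of the `n`-th convergent of `x` (so `q₀ = 1`, `q₁ = a₁`,
`q_{n+2} = a_{n+2} q_{n+1} + q_n`). -/
def cfDenom (x : ℝ) (n : ℕ) : ℝ := (GenContFract.of x).dens n

/-- The level set `F_α` of the arithmetic-geometric scaling: all irrational `x ∈ (0,1)` with
`log (a₁(x) ⋯ a_n(x)) / log q_n(x) → α`. -/
def scalingLevelSet (α : ℝ) : Set ℝ :=
  {x | x ∈ unitIrrationals ∧
    Tendsto (fun n : ℕ =>
      Real.log (∏ i ∈ Finset.range n, cfDigit x i) / Real.log (cfDenom x n)) atTop (𝓝 α)}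

/-- The arithmetic-geometric scaling spectrum `f(α) = dim_H F_α`. Subsets of `ℝ` have Hausdorff
dimension at most `1`, so that nothing is lost by passing to real numbers. -/
def scalingSpectrum (α : ℝ) : ℝ := (dimH (scalingLevelSet α)).toReal

/-- The comparison function `log log (1/(1-α)) / log (1/(1-α))`. -/
def logLogRatio (α : ℝ) : ℝ := Real.log (Real.log (1 / (1 - α))) / Real.log (1 / (1 - α))

end

/-! Put `δ = 1 - α = exp (-D)`, so that the correction to `1/2` has order `log D / D`. A cylinder of
order `n` has length at most `q_n ^ (-2)`, and on the level set the product of the digits is `q_n ^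
(1 - δ + o(1))`. Since `log q_n` gains roughly `log (1 + 1/N)` over the log-product from adjacent
digits of product `N`, typical digits must be at least of order `δ ^ (-1/2)`, up to logarithms.
Dimension `(1 + η) / 2` then corresponds to `∑ a ^ (-(1 + η))` over large digits being about `1`,
which gives `η` of order `log D / D`.

Lower bound (`le_dimH_scalingLevelSet`): draw independent digits from `[A, B]` with probabilities at
most `a ^ (-(1 + η))`, and insert a digit `1` whenever the product exceeds `q_n ^ (1 - δ)`. This
feedback keeps `(1 - δ) log q_n` within a bounded distance of the log-product
(`IsSteered.discrepancy_mem`), so every resulting point has ratio tending to `1 - δ`. Inserted ones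
do not change the product, hence cylinders have mass at most a constant times `q_n ^ (-(1 - δ)(1 +
η))`. Bounded digits separate distinct cylinders (`IsExpansion.le_abs_sub`), and the mass
distribution principle applies.

Upper bound (`dimH_largeProductSet_le`): cover by cylinders of even order. Grouping digits in pairs
gives `q_{2k} ≥ ∏ (N_j + 1)` with `N_j` the product of the `j`-th pair. A Chernoff-type weight with
parameter `t` turns the lower bound on the total product into a factor for each pair
(`rpow_contDen_le_prod`), and the covering sum becomes the `k`-th power of a number at most `1`. -/

open MeasureTheory
open scoped ENNReal

/-! ### Continuants -/

/-- The continuants of a digit sequence, shifted by one: `contDen d (n + 1)` is the denominator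
`q_n` of the `n`-th convergent, and `contDen d 0 = q_{-1} = 0`. -/
def contDen (d : ℕ → ℕ) : ℕ → ℝ
  | 0 => 0
  | 1 => 1
  | n + 2 => d n * contDen d (n + 1) + contDen d n

/-- The numerators of the convergents, shifted by one as in `contDen`. -/
def contNum (d : ℕ → ℕ) : ℕ → ℝ
  | 0 => 1
  | 1 => 0
  | n + 2 => d n * contNum d (n + 1) + contNum d n

/-- `d` is the sequence of digits and `y` the sequence of tails of the continued fraction expansion
of `x`. -/
structure IsExpansion (x : ℝ) (d : ℕ → ℕ) (y : ℕ → ℝ) : Prop where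
  zero : y 0 = x
  pos : ∀ n, 0 < y n
  lt_one : ∀ n, y n < 1
  inv : ∀ n, (y n)⁻¹ = d n + y (n + 1)

theorem contDen_nonneg (d : ℕ → ℕ) (n : ℕ) : 0 ≤ contDen d n ∧ 0 ≤ contDen d (n + 1) := by
  induction n with
  | zero => simp [contDen]
  | succ n ih =>
    refine ⟨ih.2, ?_⟩
    rw [contDen]
    have := ih.1
    have := ih.2
    positivity

theorem contDen_congr {d d' : ℕ → ℕ} {n : ℕ} (h : ∀ i < n, d i = d' i) :
    ∀ m ≤ n + 1, contDen d m = contDen d' m := by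
  intro m
  induction m using Nat.strong_induction_on with
  | _ m ih =>
    match m with
    | 0 => intro _; rfl
    | 1 => intro _; rfl
    | m + 2 =>
      intro hm
      rw [contDen, contDen, h m (by omega), ih (m + 1) (by omega) (by omega),
        ih m (by omega) (by omega)]

theorem contNum_congr {d d' : ℕ → ℕ} {n : ℕ} (h : ∀ i < n, d i = d' i) :
    ∀ m ≤ n + 1, contNum d m = contNum d' m := by
  intro m
  induction m using Nat.strong_induction_on with
  | _ m ih =>
    match m with
    | 0 => intro _; rfl
    | 1 => intro _; rfl
    | m + 2 =>
      intro hm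
      rw [contNum, contNum, h m (by omega), ih (m + 1) (by omega) (by omega),
        ih m (by omega) (by omega)]

theorem contNum_mul_contDen_sub (d : ℕ → ℕ) (n : ℕ) :
    contNum d (n + 1) * contDen d n - contNum d n * contDen d (n + 1) = (-1) ^ (n + 1) := by
  induction n with
  | zero => simp [contDen, contNum]
  | succ n ih =>
    rw [contNum, contDen, pow_succ, ← ih]
    ring

theorem one_le_contDen {d : ℕ → ℕ} (hd : ∀ n, 1 ≤ d n) (n : ℕ) :
    1 ≤ contDen d (n + 1) ∧ contDen d n ≤ contDen d (n + 1) := by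
  induction n with
  | zero => simp [contDen]
  | succ n ih =>
    have h1 : (1 : ℝ) ≤ d n := by exact_mod_cast hd n
    have h0 := (contDen_nonneg d n).1
    have : contDen d (n + 1) ≤ contDen d (n + 2) := by
      rw [contDen]
      nlinarith [ih.1]
    exact ⟨ih.1.trans this, this⟩

theorem two_pow_le_contDen {d : ℕ → ℕ} (hd : ∀ n, 1 ≤ d n) (k : ℕ) :
    (2 : ℝ) ^ k ≤ contDen d (2 * k + 1) := by
  induction k with
  | zero => simp [contDen]
  | succ k ih =>
    have h1 : (1 : ℝ) ≤ d (2 * k + 1) := by exact_mod_cast hd _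
    have h2 := (one_le_contDen hd (2 * k + 1)).2
    have h3 := (one_le_contDen hd (2 * k + 1)).1
    rw [show 2 * (k + 1) + 1 = 2 * k + 1 + 2 by ring, contDen, pow_succ]
    nlinarith

/-- Two steps of the recurrence give `q_{n+2} ≥ (d d' + 1) q_n`. The `+ 1` in each pair records how
far `q` outgrows the product of the digits, which drives the upper bound. -/
theorem prod_pairs_le_contDen {d : ℕ → ℕ} (k : ℕ) :
    ∏ j ∈ Finset.range k, ((d (2 * j) * d (2 * j + 1) : ℝ) + 1) ≤ contDen d (2 * k + 1) := by
  induction k with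
  | zero => simp [contDen]
  | succ k ih =>
    have h1 := (contDen_nonneg d (2 * k)).1
    rw [show 2 * (k + 1) + 1 = 2 * k + 1 + 2 by ring, contDen, contDen, Finset.prod_range_succ]
    have h2 : (0 : ℝ) ≤ d (2 * k) * d (2 * k + 1) + 1 := by positivity
    have h3 : (0 : ℝ) ≤ d (2 * k + 1) * contDen d (2 * k) := by positivity
    nlinarith [mul_le_mul_of_nonneg_right ih h2]

theorem tendsto_contDen {d : ℕ → ℕ} (hd : ∀ n, 1 ≤ d n) :
    Tendsto (fun n => contDen d (n + 1)) atTop atTop := by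
  have hmono : Monotone fun n => contDen d (n + 1) :=
    monotone_nat_of_le_succ fun n => (one_le_contDen hd (n + 1)).2
  refine hmono.tendsto_atTop_atTop fun b => ?_
  obtain ⟨k, hk⟩ := pow_unbounded_of_one_lt b (one_lt_two : (1 : ℝ) < 2)
  exact ⟨2 * k, hk.le.trans (two_pow_le_contDen hd k)⟩

/-! ### Expansions, distances between points, and agreement with `GenContFract` -/

namespace IsExpansion

variable {x x' : ℝ} {d d' : ℕ → ℕ} {y y' : ℕ → ℝ}

theorem one_le (h : IsExpansion x d y) (n : ℕ) : 1 ≤ d n := by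
  have h1 := (one_lt_inv₀ (h.pos n)).2 (h.lt_one n)
  rw [h.inv] at h1
  have h2 := h.lt_one (n + 1)
  have : (0 : ℝ) < d n := by linarith
  exact_mod_cast this

theorem mul_eq_one (h : IsExpansion x d y) (n : ℕ) : y n * (d n + y (n + 1)) = 1 := by
  rw [← h.inv, mul_inv_cancel₀ (h.pos n).ne']

theorem mul_eq (h : IsExpansion x d y) (n : ℕ) :
    x * (contDen d (n + 1) + contDen d n * y n) = contNum d (n + 1) + contNum d n * y n := by
  induction n with
  | zero => simp [contDen, contNum, h.zero]
  | succ n ih =>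
    have h1 := h.mul_eq_one n
    have h2 := (h.pos n).ne'
    apply mul_left_cancel₀ h2
    rw [contDen, contNum]
    linear_combination ih + (x * contDen d (n + 1) - contNum d (n + 1)) * h1

/-- Both points are images of their tails under the same Möbius map, whose determinant is `±1`. -/
theorem abs_sub_mul (h : IsExpansion x d y) (h' : IsExpansion x' d' y') {n : ℕ}
    (hn : ∀ i < n, d i = d' i) :
    |x - x'| * ((contDen d (n + 1) + contDen d n * y n) *
      (contDen d (n + 1) + contDen d n * y' n)) = |y n - y' n| := by
  have e := h.mul_eq n
  have e' := h'.mul_eq n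
  rw [← contDen_congr hn _ (by omega), ← contDen_congr hn _ (by omega),
    ← contNum_congr hn _ (by omega), ← contNum_congr hn _ (by omega)] at e'
  have hdet := contNum_mul_contDen_sub d n
  have hp := h.pos n
  have hp' := h'.pos n
  have hq := contDen_nonneg d n
  have key : (x - x') * ((contDen d (n + 1) + contDen d n * y n) *
      (contDen d (n + 1) + contDen d n * y' n)) = (-1) ^ (n + 1) * (y' n - y n) := by
    rw [← hdet]
    linear_combination (contDen d (n + 1) + contDen d n * y' n) * e -
      (contDen d (n + 1) + contDen d n * y n) * e'
  have h0 : 0 ≤ (contDen d (n + 1) + contDen d n * y n) *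
      (contDen d (n + 1) + contDen d n * y' n) := by
    have := hq.1
    have := hq.2
    positivity
  rw [← abs_of_nonneg h0, ← abs_mul, key, abs_mul, abs_pow, abs_neg, abs_one, one_pow, one_mul,
    abs_sub_comm]

theorem abs_sub_le (h : IsExpansion x d y) (h' : IsExpansion x' d' y') {n : ℕ}
    (hn : ∀ i < n, d i = d' i) : |x - x'| * contDen d (n + 1) ^ 2 ≤ 1 := by
  have e := abs_sub_mul h h' hn
  have hp := h.pos n
  have hp' := h'.pos n
  have hq := contDen_nonneg d n
  have h1 : |y n - y' n| ≤ 1 := by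
    rw [abs_le]
    constructor <;> linarith [h.lt_one n, h'.lt_one n]
  refine le_trans ?_ (e.le.trans h1)
  refine mul_le_mul_of_nonneg_left ?_ (abs_nonneg _)
  rw [sq]
  have := hq.1
  have := hq.2
  have h2 : 0 ≤ contDen d n * y n := by positivity
  have h3 : 0 ≤ contDen d n * y' n := by positivity
  gcongr <;> linarith

theorem inv_le_tail (h : IsExpansion x d y) {B : ℕ} (hB : ∀ n, d n ≤ B) (n : ℕ) :
    1 ≤ y n * (B + 1) := by
  have h1 := h.mul_eq_one n
  have h2 : (d n : ℝ) ≤ B := by exact_mod_cast hB n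
  have := h.pos n
  have := h.lt_one (n + 1)
  nlinarith

theorem tail_le (h : IsExpansion x d y) {B : ℕ} (hB : ∀ n, d n ≤ B) (n : ℕ) :
    y n * (B + 2) ≤ B + 1 := by
  have h1 := h.mul_eq_one n
  have h2 : (1 : ℝ) ≤ d n := by exact_mod_cast h.one_le n
  have h3 := h.pos n
  have h5 := h.inv_le_tail hB (n + 1)
  have h6 : y n * (1 + y (n + 1)) ≤ 1 := by nlinarith
  nlinarith

/-- With digits at most `B`, all tails lie between `1 / (B + 1)` and `(B + 1) / (B + 2)`. Where the
digits first differ, the inverse tails therefore differ by at least `1 / (B + 2)`, and `abs_sub_mul`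
carries this gap back to the points. -/
theorem le_abs_sub (h : IsExpansion x d y) (h' : IsExpansion x' d' y') {B n : ℕ}
    (hB : ∀ n, d n ≤ B) (hB' : ∀ n, d' n ≤ B) (hn : ∀ i < n, d i = d' i) (hne : d n ≠ d' n) :
    1 ≤ |x - x'| * (4 * (B + 2) ^ 3 * contDen d (n + 1) ^ 2) := by
  have e := abs_sub_mul h h' hn
  have hp := h.pos n
  have hp' := h'.pos n
  have hq := one_le_contDen h.one_le n
  have hq0 := (contDen_nonneg d n).1
  have hz : |y (n + 1) - y' (n + 1)| * (B + 2) ≤ B + 1 := by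
    have h1 := h.tail_le hB (n + 1)
    have h2 := h'.tail_le hB' (n + 1)
    have h3 := h.pos (n + 1)
    have h4 := h'.pos (n + 1)
    have h5 : |y (n + 1) - y' (n + 1)| ≤ max (y (n + 1)) (y' (n + 1)) := by
      rw [abs_le]
      constructor
      · linarith [le_max_right (y (n + 1)) (y' (n + 1))]
      · linarith [le_max_left (y (n + 1)) (y' (n + 1))]
    have h6 : max (y (n + 1)) (y' (n + 1)) * (B + 2) ≤ B + 1 := by
      rcases max_choice (y (n + 1)) (y' (n + 1)) with h | h <;> rw [h] <;> assumption
    nlinarith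
  have hd : (1 : ℝ) ≤ |(d n : ℝ) - d' n| := by
    have : (1 : ℤ) ≤ |(d n : ℤ) - d' n| := Int.one_le_abs (by omega)
    exact_mod_cast this
  have hinv : |(y n)⁻¹ - (y' n)⁻¹| * (y n * y' n) = |y n - y' n| := by
    rw [← abs_of_pos (mul_pos hp hp'), ← abs_mul, abs_sub_comm (y n)]
    congr 1
    field_simp
  have h1 : 1 ≤ |(y n)⁻¹ - (y' n)⁻¹| * (B + 2) := by
    rw [h.inv, h'.inv]
    have : |(d n : ℝ) - d' n| ≤ |(d n : ℝ) + y (n + 1) - (d' n + y' (n + 1))| +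
        |y (n + 1) - y' (n + 1)| := by
      calc |(d n : ℝ) - d' n| = |((d n : ℝ) + y (n + 1) - (d' n + y' (n + 1))) -
            (y (n + 1) - y' (n + 1))| := by ring_nf
        _ ≤ _ := abs_sub _ _
    nlinarith
  have h2 : 1 ≤ |y n - y' n| * (B + 2) ^ 3 := by
    have h3 : 1 ≤ y n * (B + 2) := by nlinarith [h.inv_le_tail hB n]
    have h4 : 1 ≤ y' n * (B + 2) := by nlinarith [h'.inv_le_tail hB' n]
    rw [← hinv]
    calc (1 : ℝ) ≤ (|(y n)⁻¹ - (y' n)⁻¹| * (B + 2)) * ((y n * (B + 2)) * (y' n * (B + 2))) :=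
          one_le_mul_of_one_le_of_one_le h1 (one_le_mul_of_one_le_of_one_le h3 h4)
      _ = _ := by ring
  refine h2.trans ?_
  rw [← e]
  have h5 : contDen d (n + 1) + contDen d n * y n ≤ 2 * contDen d (n + 1) := by
    nlinarith [h.lt_one n]
  have h6 : contDen d (n + 1) + contDen d n * y' n ≤ 2 * contDen d (n + 1) := by
    nlinarith [h'.lt_one n]
  have h7 : 0 ≤ contDen d (n + 1) + contDen d n * y' n := by
    have := hq.1
    positivity
  calc _ ≤ |x - x'| * ((2 * contDen d (n + 1)) * (2 * contDen d (n + 1))) * (B + 2) ^ 3 := by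
        gcongr
        linarith [hq.1]
    _ = _ := by ring

theorem stream_succ (h : IsExpansion x d y) (n : ℕ) :
    GenContFract.IntFractPair.stream x (n + 1) = some ⟨d n, y (n + 1)⟩ := by
  have hof : ∀ n, GenContFract.IntFractPair.of (y n)⁻¹ = ⟨d n, y (n + 1)⟩ := by
    intro n
    have h1 : ⌊(d n : ℝ) + y (n + 1)⌋ = d n := by
      rw [Int.floor_eq_iff]
      push_cast
      constructor <;> linarith [h.pos (n + 1), h.lt_one (n + 1)]
    rw [GenContFract.IntFractPair.of, h.inv, Int.fract, h1]
    simp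
  induction n with
  | zero =>
    have h1 : GenContFract.IntFractPair.stream x 0 = some ⟨0, y 0⟩ := by
      have h2 : ⌊x⌋ = 0 := by
        rw [Int.floor_eq_iff, ← h.zero]
        constructor <;> push_cast <;> linarith [h.pos 0, h.lt_one 0]
      rw [GenContFract.IntFractPair.stream_zero, GenContFract.IntFractPair.of, Int.fract, h2,
        h.zero]
      simp
    rw [GenContFract.IntFractPair.stream_succ_of_some h1 (h.pos 0).ne', hof]
  | succ n ih =>
    rw [GenContFract.IntFractPair.stream_succ_of_some ih (h.pos _).ne', hof]

theorem get?_of (h : IsExpansion x d y) (n : ℕ) :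
    (GenContFract.of x).s.get? n = some ⟨1, d n⟩ := by
  rw [GenContFract.get?_of_eq_some_of_succ_get?_intFractPair_stream (h.stream_succ n)]
  simp

theorem cfDigit_eq (h : IsExpansion x d y) (n : ℕ) : cfDigit x n = d n := by
  rw [cfDigit, GenContFract.partDen_eq_s_b (h.get?_of n)]
  rfl

theorem cfDenom_eq (h : IsExpansion x d y) (n : ℕ) : cfDenom x n = contDen d (n + 1) := by
  have key : ∀ n, cfDenom x n = contDen d (n + 1) ∧ cfDenom x (n + 1) = contDen d (n + 2) := by
    intro n
    induction n with
    | zero =>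
      refine ⟨GenContFract.zeroth_den_eq_one, ?_⟩
      rw [cfDenom, GenContFract.first_den_eq (h.get?_of 0)]
      simp [contDen]
    | succ n ih =>
      refine ⟨ih.2, ?_⟩
      rw [cfDenom, GenContFract.dens_recurrence (h.get?_of (n + 1)) ih.1 ih.2]
      simp [contDen]
  exact (key n).1

theorem mem_unitIrrationals (h : IsExpansion x d y) : x ∈ unitIrrationals := by
  refine ⟨h.zero ▸ ⟨h.pos 0, h.lt_one 0⟩, ?_⟩
  rintro ⟨q, hq⟩
  have := (GenContFract.terminates_iff_rat x).2 ⟨q, hq.symm⟩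
  obtain ⟨n, hn⟩ := this
  rw [← GenContFract.terminatedAt_iff_s_terminatedAt,
    GenContFract.of_terminatedAt_n_iff_succ_nth_intFractPair_stream_eq_none,
    h.stream_succ n] at hn
  cases hn

end IsExpansion

/-! ### Existence of expansions, convergence and measurability -/

theorem exists_isExpansion {x : ℝ} (hx : x ∈ unitIrrationals) :
    ∃ d y, IsExpansion x d y := by
  let y : ℕ → ℝ := fun n => (fun z : ℝ => Int.fract z⁻¹)^[n] x
  have hsucc : ∀ n, y (n + 1) = Int.fract (y n)⁻¹ := fun n => Function.iterate_succ_apply' _ _ _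
  have hirr : ∀ n, y n ∈ unitIrrationals := by
    intro n
    induction n with
    | zero => exact hx
    | succ n ih =>
      have h1 : Irrational (y (n + 1)) := by
        rw [hsucc, Int.fract]
        exact (irrational_inv_iff.2 ih.2).sub_intCast _
      refine ⟨⟨lt_of_le_of_ne ?_ h1.ne_zero.symm, ?_⟩, h1⟩
      · rw [hsucc]; exact Int.fract_nonneg _
      · rw [hsucc]; exact Int.fract_lt_one _
  refine ⟨fun n => ⌊(y n)⁻¹⌋.toNat, y, rfl, fun n => (hirr n).1.1, fun n => (hirr n).1.2,
    fun n => ?_⟩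
  have h0 : 0 ≤ ⌊(y n)⁻¹⌋ := Int.floor_nonneg.2 (inv_nonneg.2 (hirr n).1.1.le)
  have h1 : ((⌊(y n)⁻¹⌋.toNat : ℕ) : ℝ) = ((⌊(y n)⁻¹⌋ : ℤ) : ℝ) := by
    exact_mod_cast Int.toNat_of_nonneg h0
  rw [h1, hsucc, Int.floor_add_fract]

theorem IsExpansion.tendsto_conv {x : ℝ} {d : ℕ → ℕ} {y : ℕ → ℝ} (h : IsExpansion x d y) :
    Tendsto (fun n => contNum d (n + 1) / contDen d (n + 1)) atTop (𝓝 x) := by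
  rw [tendsto_iff_dist_tendsto_zero]
  refine squeeze_zero (fun _ => dist_nonneg) (fun n => ?_)
    (tendsto_inv_atTop_zero.comp (tendsto_contDen h.one_le))
  have hq := (one_le_contDen h.one_le n).1
  have hq0 := (contDen_nonneg d n).1
  have hy := h.pos n
  have hy1 := h.lt_one n
  have e : (contNum d (n + 1) - x * contDen d (n + 1)) * (contDen d (n + 1) + contDen d n * y n)
      = (-1) ^ (n + 1) * y n := by
    rw [← contNum_mul_contDen_sub]
    linear_combination - contDen d (n + 1) * h.mul_eq n
  have hpos : 1 ≤ contDen d (n + 1) + contDen d n * y n := by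
    have : 0 ≤ contDen d n * y n := by positivity
    linarith
  have e' := congrArg abs e
  rw [abs_mul, abs_mul, abs_pow, abs_neg, abs_one, one_pow, one_mul, abs_of_pos hy,
    abs_of_pos (by linarith : 0 < contDen d (n + 1) + contDen d n * y n)] at e'
  have h1 : |contNum d (n + 1) - x * contDen d (n + 1)| ≤ 1 := by
    nlinarith [abs_nonneg (contNum d (n + 1) - x * contDen d (n + 1))]
  have h2 : contNum d (n + 1) / contDen d (n + 1) - x =
      (contNum d (n + 1) - x * contDen d (n + 1)) * (contDen d (n + 1))⁻¹ := by
    field_simp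
  rw [Real.dist_eq, h2, abs_mul, abs_of_pos (inv_pos.2 (by linarith : 0 < contDen d (n + 1)))]
  exact mul_le_of_le_one_left (by positivity) h1

/-- The point comes from compactness, as a common element of the nested cylinder intervals `g n ''
[0, 1]`; its preimages under the maps `g n` are the tails. -/
theorem exists_isExpansion_of_digits {d : ℕ → ℕ} (hd : ∀ n, 1 ≤ d n) :
    ∃ x y, IsExpansion x d y := by
  have hden : ∀ n, ∀ t ∈ Set.Icc (0 : ℝ) 1, contDen d (n + 1) + contDen d n * t ≠ 0 := by
    intro n t ht
    have h1 := (one_le_contDen hd n).1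
    have h2 := mul_nonneg (contDen_nonneg d n).1 ht.1
    linarith
  let g : ℕ → ℝ → ℝ := fun n t =>
    (contNum d (n + 1) + contNum d n * t) / (contDen d (n + 1) + contDen d n * t)
  have hcompact : ∀ n, IsCompact (g n '' Set.Icc 0 1) := fun n =>
    isCompact_Icc.image_of_continuousOn
      (ContinuousOn.div (by fun_prop) (by fun_prop) (hden n))
  have hdpos : ∀ n, (1 : ℝ) ≤ d n := fun n => by exact_mod_cast hd n
  have hne := IsCompact.nonempty_iInter_of_sequence_nonempty_isCompact_isClosed
    (fun n => g n '' Set.Icc 0 1) (fun n => ?_)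
    (fun n => (Set.nonempty_Icc.2 zero_le_one).image _) (hcompact 0)
    (fun n => (hcompact n).isClosed)
  swap
  · rintro _ ⟨t, ht, rfl⟩
    have h1 : 0 < d n + t := by linarith [hdpos n, ht.1]
    have h2 : (d n + t)⁻¹ ∈ Set.Icc (0 : ℝ) 1 :=
      ⟨by positivity, inv_le_one_of_one_le₀ (by linarith [hdpos n, ht.1])⟩
    refine ⟨(d n + t)⁻¹, h2, ?_⟩
    have h3 := hden n _ h2
    have h4 := hden (n + 1) t ht
    simp only [g]
    rw [div_eq_div_iff h3 h4, contDen, contNum]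
    field_simp
    ring
  obtain ⟨x, hx⟩ := hne
  rw [Set.mem_iInter] at hx
  choose y hy hxy using hx
  have hmul : ∀ n, x * (contDen d (n + 1) + contDen d n * y n) =
      contNum d (n + 1) + contNum d n * y n := by
    intro n
    rw [← hxy n]
    exact div_mul_cancel₀ _ (hden n _ (hy n))
  have hinv : ∀ n, y n * (d n + y (n + 1)) = 1 := by
    intro n
    have e1 := hmul n
    have e2 := hmul (n + 1)
    rw [contDen, contNum] at e2
    have e3 : (contNum d (n + 1) - x * contDen d (n + 1)) * (y n * (d n + y (n + 1)) - 1) = 0 := by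
      linear_combination e1 - y n * e2
    rcases mul_eq_zero.1 e3 with h0 | h0
    -- If `x` equalled the `n`-th convergent, it would satisfy the same linear relation one index
    -- earlier, against the determinant being `±1`.
    · exfalso
      have e4 : x * contDen d n - contNum d n = 0 := by
        linear_combination e2 + (d n + y (n + 1)) * h0
      have := contNum_mul_contDen_sub d n
      have e5 : ((-1 : ℝ)) ^ (n + 1) = 0 := by
        rw [← this]
        linear_combination contDen d n * h0 + contDen d (n + 1) * e4
      exact pow_ne_zero _ (by norm_num) e5
    · linarith
  have hpos : ∀ n, 0 < y n := fun n =>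
    lt_of_le_of_ne (hy n).1 fun h0 => by
      have := hinv n
      rw [← h0] at this
      simp at this
  refine ⟨x, y, ?_, hpos, fun n => ?_, fun n => ?_⟩
  · have := hmul 0
    simpa [contDen, contNum] using this.symm
  · have h1 := hinv n
    have h2 := hpos n
    have h3 := hpos (n + 1)
    nlinarith [hdpos n]
  · exact inv_eq_of_mul_eq_one_right (hinv n)

theorem measurable_contDen {Ω : Type*} [MeasurableSpace Ω] {d : Ω → ℕ → ℕ}
    (hd : ∀ n, Measurable fun w => d w n) (n : ℕ) : Measurable fun w => contDen (d w) n := by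
  have key : (Measurable fun w => contDen (d w) n) ∧ Measurable fun w => contDen (d w) (n + 1) := by
    induction n with
    | zero => exact ⟨measurable_const, measurable_const⟩
    | succ n ih =>
      refine ⟨ih.2, ?_⟩
      have h : Measurable fun w => (d w n : ℝ) := (measurable_from_top).comp (hd n)
      exact (h.mul ih.2).add ih.1
  exact key.1

theorem measurable_contNum {Ω : Type*} [MeasurableSpace Ω] {d : Ω → ℕ → ℕ}
    (hd : ∀ n, Measurable fun w => d w n) (n : ℕ) : Measurable fun w => contNum (d w) n := by
  have key : (Measurable fun w => contNum (d w) n) ∧ Measurable fun w => contNum (d w) (n + 1) := by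
    induction n with
    | zero => exact ⟨measurable_const, measurable_const⟩
    | succ n ih =>
      refine ⟨ih.2, ?_⟩
      have h : Measurable fun w => (d w n : ℝ) := (measurable_from_top).comp (hd n)
      exact (h.mul ih.2).add ih.1
  exact key.1

/-! ### Steered digit sequences -/

/-- A digit sequence is forced at `n` if its product of digits so far exceeds `q_n ^ (1 - δ)`. -/
def IsForced (δ : ℝ) (d : ℕ → ℕ) (n : ℕ) : Prop :=
  (1 - δ) * Real.log (contDen d (n + 1)) < Real.log (∏ i ∈ Finset.range n, (d i : ℝ))

theorem IsForced.congr {δ : ℝ} {d d' : ℕ → ℕ} {n : ℕ} (h : ∀ i < n, d i = d' i) :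
    IsForced δ d n ↔ IsForced δ d' n := by
  rw [IsForced, IsForced, contDen_congr h _ le_rfl,
    Finset.prod_congr rfl fun i hi => by rw [h i (Finset.mem_range.1 hi)]]

/-- `d` uses the digit `1` at the forced positions and copies `w` elsewhere. -/
def IsSteered (δ : ℝ) (w d : ℕ → ℕ) : Prop :=
  ∀ n, (IsForced δ d n → d n = 1) ∧ (¬ IsForced δ d n → d n = w n)

-- Whether a position is forced depends only on earlier digits, so the sequence is built by
-- recursion on the state `(q_{n-1}, q_n, product)`, each step of which is measurable.
open Classical in
theorem exists_isSteered {Ω : Type*} [MeasurableSpace Ω] (δ : ℝ) {w : Ω → ℕ → ℕ}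
    (hw : ∀ n, Measurable fun ω => w ω n) :
    ∃ d : Ω → ℕ → ℕ, (∀ n, Measurable fun ω => d ω n) ∧ ∀ ω, IsSteered δ (w ω) (d ω) := by
  let dig : ℝ × ℝ × ℝ → ℕ → ℕ := fun s a =>
    if (1 - δ) * Real.log s.2.1 < Real.log s.2.2 then 1 else a
  let st : Ω → ℕ → ℝ × ℝ × ℝ := fun ω n => Nat.rec (0, 1, 1)
    (fun n s => (s.2.1, dig s (w ω n) * s.2.1 + s.1, s.2.2 * dig s (w ω n))) n
  have hst : ∀ ω n, st ω (n + 1) = ((st ω n).2.1,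
      dig (st ω n) (w ω n) * (st ω n).2.1 + (st ω n).1,
      (st ω n).2.2 * dig (st ω n) (w ω n)) := fun _ _ => rfl
  have hdig : Measurable fun p : (ℝ × ℝ × ℝ) × ℕ => dig p.1 p.2 := by
    refine Measurable.ite (measurableSet_lt ?_ ?_) measurable_const measurable_snd
    · exact (Real.measurable_log.comp (by fun_prop)).const_mul _
    · exact Real.measurable_log.comp (by fun_prop)
  have hmeas : ∀ n, Measurable fun ω => st ω n := by
    intro n
    induction n with
    | zero => exact measurable_const
    | succ n ih =>
      have h1 : Measurable fun ω => (dig (st ω n) (w ω n) : ℝ) :=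
        (measurable_from_top).comp (hdig.comp (ih.prodMk (hw n)))
      simp only [hst]
      fun_prop
  refine ⟨fun ω n => dig (st ω n) (w ω n), fun n => hdig.comp ((hmeas n).prodMk (hw n)),
    fun ω => ?_⟩
  have hspec : ∀ n, (st ω n).1 = contDen (fun n => dig (st ω n) (w ω n)) n ∧
      (st ω n).2.1 = contDen (fun n => dig (st ω n) (w ω n)) (n + 1) ∧
      (st ω n).2.2 = ∏ i ∈ Finset.range n, (dig (st ω i) (w ω i) : ℝ) := by
    intro n
    induction n with
    | zero => exact ⟨rfl, rfl, by simp [st]⟩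
    | succ n ih =>
      rw [hst]
      refine ⟨ih.2.1, ?_, ?_⟩
      · rw [contDen, ← ih.1, ← ih.2.1]
      · rw [Finset.prod_range_succ, ← ih.2.2]
  intro n
  have h1 : IsForced δ (fun n => dig (st ω n) (w ω n)) n ↔
      (1 - δ) * Real.log (st ω n).2.1 < Real.log (st ω n).2.2 := by
    rw [IsForced, (hspec n).2.1, (hspec n).2.2]
  rw [h1]
  exact ⟨fun h => if_pos h, fun h => if_neg h⟩

namespace IsSteered

variable {δ : ℝ} {w d : ℕ → ℕ} {A B : ℕ}

theorem one_le (h : IsSteered δ w d) (hw : ∀ n, 1 ≤ w n) (n : ℕ) : 1 ≤ d n := by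
  by_cases hf : IsForced δ d n
  · exact ((h n).1 hf).ge
  · exact (h n).2 hf ▸ hw n

theorem le (h : IsSteered δ w d) (hw : ∀ n, w n ≤ B) (hB : 1 ≤ B) (n : ℕ) : d n ≤ B := by
  by_cases hf : IsForced δ d n
  · exact ((h n).1 hf).trans_le hB
  · exact (h n).2 hf ▸ hw n

/-- The discrepancy rises by at most `1` per step. It is negative at forced steps, and a free step
following a free one does not raise it: the gain is at most `1 / A ^ 2`, the loss at least `δ log
A`. -/
theorem discrepancy_mem (h : IsSteered δ w d) (hδ : 0 ≤ δ) (hδ1 : δ ≤ 1) (hA : 1 ≤ A)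
    (hAδ : 1 ≤ δ * Real.log A * A ^ 2) (hAw : ∀ n, A ≤ w n) (hwB : ∀ n, w n ≤ B) (n : ℕ) :
    (1 - δ) * Real.log (contDen d (n + 1)) - Real.log (∏ i ∈ Finset.range n, (d i : ℝ)) ∈
      Set.Icc (-(δ * Real.log B)) 2 := by
  have hd := h.one_le fun n => hA.trans (hAw n)
  have hA' : (1 : ℝ) ≤ A := by exact_mod_cast hA
  have hB' : (1 : ℝ) ≤ B := by exact_mod_cast hA.trans ((hAw 0).trans (hwB 0))
  have hB0 : 0 ≤ δ * Real.log B := mul_nonneg hδ (Real.log_nonneg hB')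
  set s : ℕ → ℝ := fun n => (1 - δ) * Real.log (contDen d (n + 1)) -
    Real.log (∏ i ∈ Finset.range n, (d i : ℝ)) with hs
  -- The second alternative says that the preceding digit was large. When it fails, the discrepancy
  -- is at most `1`, which leaves room for one more increment below `2`.
  suffices key : ∀ n, s n ∈ Set.Icc (-(δ * Real.log B)) 2 ∧
      (s n ≤ 1 ∨ contDen d n * A ≤ contDen d (n + 1)) from (key n).1
  intro n
  induction n with
  | zero =>
    have h0 : s 0 = 0 := by simp [hs, contDen]
    rw [h0]
    exact ⟨⟨by linarith, by norm_num⟩, Or.inl (by norm_num)⟩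
  | succ n ih =>
    have hq := (one_le_contDen hd n).1
    have hq0 := (contDen_nonneg d n).1
    have hqle := (one_le_contDen hd n).2
    have hdn : (1 : ℝ) ≤ d n := by exact_mod_cast hd n
    have hr : 0 ≤ contDen d n / contDen d (n + 1) := by positivity
    set r := contDen d n / contDen d (n + 1) with hrdef
    have hstep : s (n + 1) = s n + ((1 - δ) * Real.log (1 + r / d n) - δ * Real.log (d n)) := by
      have e1 : contDen d (n + 2) = contDen d (n + 1) * d n * (1 + r / d n) := by
        rw [contDen, hrdef]
        field_simp
      have hprod : ∏ i ∈ Finset.range n, (d i : ℝ) ≠ 0 :=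
        Finset.prod_ne_zero_iff.2 fun i _ => by have := hd i; positivity
      simp only [hs]
      rw [Finset.prod_range_succ, Real.log_mul hprod (by positivity), e1,
        Real.log_mul (by positivity) (by positivity), Real.log_mul (by positivity) (by positivity)]
      ring
    have hlog0 : 0 ≤ Real.log (1 + r / d n) := Real.log_nonneg (by
      have : 0 ≤ r / d n := by positivity
      linarith)
    have hlog1 : (1 - δ) * Real.log (1 + r / d n) ≤ r / d n := by
      have := Real.log_le_sub_one_of_pos (by positivity : 0 < 1 + r / d n)
      nlinarith
    have hlogm : 0 ≤ (1 - δ) * Real.log (1 + r / d n) := mul_nonneg (by linarith) hlog0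
    have hr1 : r ≤ 1 := by
      rw [hrdef, div_le_one (by linarith)]
      exact hqle
    have hrd : r / d n ≤ 1 := by
      rw [div_le_one (by linarith)]
      linarith
    by_cases hf : IsForced δ d n
    · have hd1 := (h n).1 hf
      have hneg : s n < 0 := by
        rw [IsForced] at hf
        simp only [hs]
        linarith
      rw [hd1, Nat.cast_one, Real.log_one] at hstep
      rw [hd1, Nat.cast_one] at hlogm hlog1
      have := ih.1.1
      have h1 : s (n + 1) ≤ 1 := by linarith
      exact ⟨⟨by linarith, by linarith⟩, Or.inl h1⟩
    · have hdw := (h n).2 hf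
      have hnn : 0 ≤ s n := by
        rw [IsForced] at hf
        simp only [hs]
        linarith
      have hAd : (A : ℝ) ≤ d n := by rw [hdw]; exact_mod_cast hAw n
      have hdB : (d n : ℝ) ≤ B := by rw [hdw]; exact_mod_cast hwB n
      have hl1 : δ * Real.log A ≤ δ * Real.log (d n) :=
        mul_le_mul_of_nonneg_left (Real.log_le_log (by linarith) hAd) hδ
      have hl2 : δ * Real.log (d n) ≤ δ * Real.log B :=
        mul_le_mul_of_nonneg_left (Real.log_le_log (by linarith) hdB) hδ
      have hl0 : 0 ≤ δ * Real.log A := mul_nonneg hδ (Real.log_nonneg hA')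
      refine ⟨⟨by linarith, ?_⟩, Or.inr ?_⟩
      · rcases ih.2 with h1 | h1
        · linarith
        · have h2 : r / d n ≤ δ * Real.log A := by
            have h3 : r * A ≤ 1 := by
              rw [hrdef, div_mul_eq_mul_div, div_le_one (by linarith)]
              exact h1
            have h4 : r / d n ≤ r / A := div_le_div_of_nonneg_left hr (by linarith) hAd
            have h5 : r / A ≤ 1 / (A : ℝ) ^ 2 := by
              rw [div_le_div_iff₀ (by linarith) (by positivity)]
              nlinarith
            have h6 : 1 / (A : ℝ) ^ 2 ≤ δ * Real.log A := by
              rw [div_le_iff₀ (by positivity)]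
              exact hAδ
            linarith
          linarith [ih.1.2]
      · rw [contDen]
        nlinarith

theorem tendsto (h : IsSteered δ w d) (hδ : 0 ≤ δ) (hδ1 : δ ≤ 1) (hA : 1 ≤ A)
    (hAδ : 1 ≤ δ * Real.log A * A ^ 2) (hAw : ∀ n, A ≤ w n) (hwB : ∀ n, w n ≤ B) :
    Tendsto (fun n => Real.log (∏ i ∈ Finset.range n, (d i : ℝ)) / Real.log (contDen d (n + 1)))
      atTop (𝓝 (1 - δ)) := by
  have hd := h.one_le fun n => hA.trans (hAw n)
  have hlog : Tendsto (fun n => Real.log (contDen d (n + 1))) atTop atTop :=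
    Real.tendsto_log_atTop.comp (tendsto_contDen hd)
  set s : ℕ → ℝ := fun n => (1 - δ) * Real.log (contDen d (n + 1)) -
    Real.log (∏ i ∈ Finset.range n, (d i : ℝ)) with hs
  have hmem := h.discrepancy_mem hδ hδ1 hA hAδ hAw hwB
  have h0 : Tendsto (fun n => s n / Real.log (contDen d (n + 1))) atTop (𝓝 0) := by
    refine tendsto_bdd_div_atTop_nhds_zero (b := -(δ * Real.log B)) (B := 2) ?_ ?_ hlog
    · exact Eventually.of_forall fun n => (hmem n).1
    · exact Eventually.of_forall fun n => (hmem n).2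
  have h1 := h0.const_sub (1 - δ)
  rw [sub_zero] at h1
  refine h1.congr' ?_
  filter_upwards [hlog.eventually_gt_atTop 0] with n hn
  simp only [hs]
  field_simp
  ring

end IsSteered

/-! ### Lower bound for the dimension by mass distribution -/

/-- Normalising weights of total at least `1` can only decrease them. -/
theorem exists_probabilityMeasure_singleton_le {ι : Type*} [Fintype ι] [MeasurableSpace ι]
    [MeasurableSingletonClass ι] {f : ι → ℝ} (hf : ∀ i, 0 ≤ f i) (h1 : 1 ≤ ∑ i, f i) :
    ∃ ν : Measure ι, IsProbabilityMeasure ν ∧ ∀ i, ν {i} ≤ ENNReal.ofReal (f i) := by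
  have hsum : ∑' i, ENNReal.ofReal (f i) = ENNReal.ofReal (∑ i, f i) := by
    rw [tsum_fintype, ENNReal.ofReal_sum_of_nonneg fun i _ => hf i]
  have hone : 1 ≤ ∑' i, ENNReal.ofReal (f i) := by
    rw [hsum]
    exact ENNReal.one_le_ofReal.2 h1
  have h0 : ∑' i, ENNReal.ofReal (f i) ≠ 0 := (zero_lt_one.trans_le hone).ne'
  have htop : ∑' i, ENNReal.ofReal (f i) ≠ ∞ := hsum ▸ ENNReal.ofReal_ne_top
  refine ⟨(PMF.normalize _ h0 htop).toMeasure, inferInstance, fun i => ?_⟩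
  rw [PMF.toMeasure_apply_singleton _ _ (measurableSet_singleton i), PMF.normalize_apply]
  exact mul_le_of_le_one_right' (ENNReal.inv_le_one.2 hone)

/-- Agreement of the steered digits determines the random input at each free position, and
independence multiplies the masses there. Forced positions contribute `1 ^ (-κ) = 1`, so they cost
nothing. -/
theorem infinitePi_steered_cylinder_le {δ κ : ℝ} {A B : ℕ}
    {ν : Measure (Finset.Icc A B)} [IsProbabilityMeasure ν]
    (hν : ∀ a, ν {a} ≤ ENNReal.ofReal (((a : ℕ) : ℝ) ^ (-κ)))
    {d : (ℕ → Finset.Icc A B) → ℕ → ℕ} (hd : ∀ ω, IsSteered δ (fun n => ω n) (d ω))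
    (ω : ℕ → Finset.Icc A B) (n : ℕ) :
    Measure.infinitePi (fun _ : ℕ => ν) {ω' | ∀ i < n, d ω i = d ω' i} ≤
      ENNReal.ofReal ((∏ i ∈ Finset.range n, (d ω i : ℝ)) ^ (-κ)) := by
  classical
  let s := (Finset.range n).filter fun i => ¬ IsForced δ (d ω) i
  have hsub : {ω' | ∀ i < n, d ω i = d ω' i} ⊆ Set.pi (s : Set ℕ) fun i => {ω i} := by
    intro ω' h i hi
    obtain ⟨hin, hfree⟩ := Finset.mem_filter.1 (Finset.mem_coe.1 hi)
    have hin' := Finset.mem_range.1 hin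
    have h1 := (hd ω i).2 hfree
    have h2 := (hd ω' i).2 (by rwa [← IsForced.congr fun j hj => h j (hj.trans hin')])
    have h3 := h i hin'
    rw [h1, h2] at h3
    exact Subtype.ext h3.symm
  refine (measure_mono hsub).trans ?_
  rw [Measure.infinitePi_pi _ fun i _ => measurableSet_singleton _,
    ← Real.finsetProd_rpow _ _ fun i _ => by positivity,
    ENNReal.ofReal_prod_of_nonneg fun i _ => by positivity]
  calc ∏ i ∈ s, ν {ω i} ≤ ∏ i ∈ s, ENNReal.ofReal ((d ω i : ℝ) ^ (-κ)) := by
        refine Finset.prod_le_prod' fun i hi => ?_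
        rw [(hd ω i).2 (Finset.mem_filter.1 hi).2]
        exact hν _
    _ = ∏ i ∈ Finset.range n, ENNReal.ofReal ((d ω i : ℝ) ^ (-κ)) := by
        refine Finset.prod_subset (Finset.filter_subset _ _) fun i hi hni => ?_
        have : IsForced δ (d ω) i := by
          by_contra hc
          exact hni (Finset.mem_filter.2 ⟨hi, hc⟩)
        rw [(hd ω i).1 this]
        simp

theorem le_dimH_scalingLevelSet {δ η : ℝ} {A B : ℕ} (hδ : 0 ≤ δ) (hδ1 : δ < 1) (hη : 0 ≤ η)
    (hA : 1 ≤ A) (hAδ : 1 ≤ δ * Real.log A * A ^ 2)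
    (hsum : 1 ≤ ∑ a ∈ Finset.Icc A B, (a : ℝ) ^ (-(1 + η))) :
    ENNReal.ofReal ((1 - δ) * (1 + η) / 2) ≤ dimH (scalingLevelSet (1 - δ)) := by
  obtain ⟨ν, hνp, hν⟩ := exists_probabilityMeasure_singleton_le
    (f := fun a : Finset.Icc A B => (((a : ℕ) : ℝ)) ^ (-(1 + η)))
    (fun a => by positivity)
    (by rwa [Finset.sum_coe_sort (Finset.Icc A B) fun a : ℕ => (a : ℝ) ^ (-(1 + η))])
  obtain ⟨d, hdm, hd⟩ := exists_isSteered δ (w := fun (ω : ℕ → Finset.Icc A B) n => (ω n : ℕ))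
    fun n => measurable_subtype_coe.comp (measurable_pi_apply n)
  have hAw : ∀ (ω : ℕ → Finset.Icc A B) n, A ≤ (ω n : ℕ) :=
    fun ω n => (Finset.mem_Icc.1 (ω n).2).1
  have hwB : ∀ (ω : ℕ → Finset.Icc A B) n, (ω n : ℕ) ≤ B :=
    fun ω n => (Finset.mem_Icc.1 (ω n).2).2
  have hd1 : ∀ ω n, 1 ≤ d ω n := fun ω => (hd ω).one_le fun n => hA.trans (hAw ω n)
  choose X y hX using fun ω => exists_isExpansion_of_digits (hd1 ω)
  have hXm : Measurable X := measurable_of_tendsto_metrizable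
    (fun n => (measurable_contNum hdm (n + 1)).div (measurable_contDen hdm (n + 1)))
    (tendsto_pi_nhds.2 fun ω => (hX ω).tendsto_conv)
  have hmem : ∀ ω, X ω ∈ scalingLevelSet (1 - δ) := by
    refine fun ω => ⟨(hX ω).mem_unitIrrationals, ?_⟩
    simp only [(hX ω).cfDigit_eq, (hX ω).cfDenom_eq]
    exact (hd ω).tendsto hδ hδ1.le hA hAδ (hAw ω) (hwB ω)
  set P := Measure.infinitePi fun _ : ℕ => ν
  set s := (1 - δ) * (1 + η) / 2 with hs
  have hs0 : 0 < s := by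
    have : 0 < 1 - δ := by linarith
    positivity
  set K := Real.exp (2 * (1 + η))
  have hcyl : ∀ ω n, P {ω' | ∀ i < n, d ω i = d ω' i} ≤
      ENNReal.ofReal (K * (contDen (d ω) (n + 1) ^ 2) ^ (-s)) := by
    intro ω n
    refine (infinitePi_steered_cylinder_le hν hd ω n).trans (ENNReal.ofReal_le_ofReal ?_)
    have hdisc := ((hd ω).discrepancy_mem hδ hδ1.le hA hAδ (hAw ω) (hwB ω) n).2
    have hq := (one_le_contDen (hd1 ω) n).1
    have hP : 0 < ∏ i ∈ Finset.range n, (d ω i : ℝ) :=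
      Finset.prod_pos fun i _ => by exact_mod_cast hd1 ω i
    rw [Real.rpow_def_of_pos hP, Real.rpow_def_of_pos (by positivity), ← Real.exp_add,
      Real.exp_le_exp, Real.log_pow, hs]
    push_cast
    nlinarith
  have hw0 : 1 ≤ B := by
    by_contra hB
    have : Finset.Icc A B = ∅ := Finset.Icc_eq_empty (by omega)
    rw [this, Finset.sum_empty] at hsum
    linarith
  have hdB : ∀ ω n, d ω n ≤ B := fun ω => (hd ω).le (hwB ω) hw0
  set C : ℝ := K * (4 * (B + 2) ^ 3) ^ s
  have hC : 0 < C := by positivity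
  have hE : ∀ E : Set ℝ, P.map X E ≤ ENNReal.ofReal C * Metric.ediam E ^ s := by
    intro E
    refine (measure_mono subset_closure).trans ?_
    rw [← Metric.ediam_closure, Measure.map_apply hXm isClosed_closure.measurableSet]
    -- Passing to the closure keeps the diameter and makes the set measurable. Below, `n` is the
    -- first index at which points of the preimage disagree with `ω₀`; if there is none, the
    -- preimage lies in cylinders of vanishing mass.
    generalize closure E = E
    rcases (X ⁻¹' E).eq_empty_or_nonempty with h0 | ⟨ω₀, hω₀⟩
    · rw [h0, measure_empty]
      exact zero_le
    by_cases hex : ∃ n, ∃ ω ∈ X ⁻¹' E, d ω₀ n ≠ d ω n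
    · classical
      obtain ⟨ω, hω, hne⟩ := Nat.find_spec hex
      have hmin := fun i (hi : i < Nat.find hex) => Nat.find_min hex hi
      generalize Nat.find hex = n at *
      have hagree : ∀ ω ∈ X ⁻¹' E, ∀ i < n, d ω₀ i = d ω i := by
        intro ω hω i hi
        by_contra hc
        exact hmin i hi ⟨ω, hω, hc⟩
      refine (measure_mono (t := {ω' | ∀ i < n, d ω₀ i = d ω' i}) hagree).trans
        ((hcyl ω₀ n).trans ?_)
      have hgap := (hX ω₀).le_abs_sub (hX ω) (hdB ω₀) (hdB ω) (hagree ω hω) hne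
      have hdiam : ENNReal.ofReal |X ω₀ - X ω| ≤ Metric.ediam E := by
        rw [← Real.dist_eq, ← edist_dist]
        exact Metric.edist_le_ediam_of_mem hω₀ hω
      have hq := (one_le_contDen (hd1 ω₀) n).1
      calc ENNReal.ofReal (K * (contDen (d ω₀) (n + 1) ^ 2) ^ (-s))
          ≤ ENNReal.ofReal (C * |X ω₀ - X ω| ^ s) := by
            refine ENNReal.ofReal_le_ofReal ?_
            rw [mul_assoc K]
            refine mul_le_mul_of_nonneg_left ?_ (Real.exp_pos _).le
            rw [← Real.mul_rpow (by positivity) (abs_nonneg _),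
              Real.rpow_neg (by positivity), ← Real.inv_rpow (by positivity)]
            refine Real.rpow_le_rpow (by positivity) ?_ hs0.le
            rw [inv_le_iff_one_le_mul₀ (by positivity)]
            linarith
        _ = ENNReal.ofReal C * ENNReal.ofReal |X ω₀ - X ω| ^ s := by
            rw [ENNReal.ofReal_mul hC.le, ENNReal.ofReal_rpow_of_nonneg (abs_nonneg _) hs0.le]
        _ ≤ _ := by gcongr
    · push Not at hex
      have hlim : Tendsto (fun n => ENNReal.ofReal (K * (contDen (d ω₀) (n + 1) ^ 2) ^ (-s)))
          atTop (𝓝 0) := by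
        rw [← ENNReal.ofReal_zero, ← mul_zero K]
        refine ENNReal.tendsto_ofReal (Tendsto.const_mul _ ?_)
        exact (tendsto_rpow_neg_atTop hs0).comp
          ((tendsto_pow_atTop two_ne_zero).comp (tendsto_contDen (hd1 ω₀)))
      refine (ge_of_tendsto' hlim fun n => ?_).trans zero_le
      exact (measure_mono (t := {ω' | ∀ i < n, d ω₀ i = d ω' i})
        fun ω hω i _ => hex i ω hω).trans (hcyl ω₀ n)
  have hC0 : ENNReal.ofReal C ≠ 0 := (ENNReal.ofReal_pos.2 hC).ne'
  have hle : (ENNReal.ofReal C)⁻¹ • P.map X ≤ μH[s] := by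
    refine Measure.le_hausdorffMeasure _ _ 1 one_pos fun E _ => ?_
    rw [Measure.smul_apply, smul_eq_mul]
    refine (mul_le_mul_right (hE E) _).trans ?_
    rw [← mul_assoc, ENNReal.inv_mul_cancel hC0 ENNReal.ofReal_ne_top, one_mul]
  have hpos : μH[s] (scalingLevelSet (1 - δ)) ≠ 0 := by
    have h1 : 1 ≤ P.map X (scalingLevelSet (1 - δ)) := by
      refine le_trans ?_ (Measure.le_map_apply hXm.aemeasurable _)
      rw [show X ⁻¹' scalingLevelSet (1 - δ) = Set.univ from Set.eq_univ_of_forall hmem,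
        measure_univ]
    have h2 := hle (scalingLevelSet (1 - δ))
    rw [Measure.smul_apply, smul_eq_mul] at h2
    refine (lt_of_lt_of_le ?_ h2).ne'
    exact ENNReal.mul_pos (ENNReal.inv_ne_zero.2 ENNReal.ofReal_ne_top)
      (zero_lt_one.trans_le h1).ne'
  rw [ENNReal.ofReal]
  apply le_dimH_of_hausdorffMeasure_ne_zero
  rwa [Real.coe_toNNReal _ hs0.le]

/-! ### Power sums by telescoping -/

/-- The convex function `u ^ (-h)` lies above its tangent at `v`. Taking `u < v` bounds power sums
from above, `u > v` from below. -/
theorem rpow_neg_sub_rpow_neg_ge {u v h : ℝ} (hu : 0 < u) (hv : 0 < v) (hh : 0 ≤ h) :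
    h * (v - u) * v ^ (-(1 + h)) ≤ u ^ (-h) - v ^ (-h) := by
  have h1 : v ^ (-(1 + h)) = v ^ (-h) * v⁻¹ := by
    rw [show -(1 + h) = -h + -1 by ring, Real.rpow_add hv, Real.rpow_neg_one]
  have h2 : u ^ (-h) = v ^ (-h) * (u / v) ^ (-h) := by
    rw [← Real.mul_rpow hv.le (by positivity), mul_div_cancel₀ _ hv.ne']
  have h3 : 1 - h * (u / v - 1) ≤ (u / v) ^ (-h) := by
    rw [Real.rpow_def_of_pos (by positivity)]
    have h4 := Real.add_one_le_exp (Real.log (u / v) * -h)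
    have h5 := Real.log_le_sub_one_of_pos (by positivity : 0 < u / v)
    nlinarith
  rw [h1, h2]
  calc h * (v - u) * (v ^ (-h) * v⁻¹) = v ^ (-h) * (1 - h * (u / v - 1)) - v ^ (-h) := by
        field_simp
        ring
    _ ≤ _ := by gcongr

theorem tsum_rpow_neg_le {h : ℝ} (hh : 0 < h) :
    ∑' a : ℕ, ENNReal.ofReal ((a : ℝ) ^ (-(1 + h))) ≤ ENNReal.ofReal (1 + 1 / h) := by
  refine ENNReal.tsum_le_of_sum_range_le fun n => ?_
  rw [← ENNReal.ofReal_sum_of_nonneg fun i _ => by positivity]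
  refine ENNReal.ofReal_le_ofReal ?_
  have key : ∀ n : ℕ, ∑ a ∈ Finset.range (n + 2), (a : ℝ) ^ (-(1 + h)) ≤
      1 + (1 - ((n : ℝ) + 1) ^ (-h)) / h := by
    intro n
    induction n with
    | zero =>
      -- The term `a = 0` vanishes because `0` to a nonzero real power is `0`.
      rw [Finset.sum_range_succ, Finset.sum_range_one, Nat.cast_zero,
        Real.zero_rpow (by linarith)]
      simp
    | succ n ih =>
      rw [Finset.sum_range_succ]
      have h1 := rpow_neg_sub_rpow_neg_ge (u := (n : ℝ) + 1) (v := (n : ℝ) + 2) (by positivity)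
        (by positivity) hh.le
      push_cast
      rw [show (n : ℝ) + 1 + 1 = n + 2 by ring]
      have h2 : ((n : ℝ) + 2) ^ (-(1 + h)) ≤
          (((n : ℝ) + 1) ^ (-h) - ((n : ℝ) + 2) ^ (-h)) / h := by
        rw [le_div_iff₀ hh]
        linarith
      have h3 : (1 - ((n : ℝ) + 2) ^ (-h)) / h = (1 - ((n : ℝ) + 1) ^ (-h)) / h +
          (((n : ℝ) + 1) ^ (-h) - ((n : ℝ) + 2) ^ (-h)) / h := by ring
      rw [h3]
      linarith
  calc _ ≤ ∑ a ∈ Finset.range (n + 2), (a : ℝ) ^ (-(1 + h)) :=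
        Finset.sum_le_sum_of_subset_of_nonneg (Finset.range_subset_range.2 (by omega))
          fun _ _ _ => by positivity
    _ ≤ _ := key n
    _ ≤ _ := by
      gcongr
      have : 0 ≤ ((n : ℝ) + 1) ^ (-h) := by positivity
      linarith

theorem one_le_sum_Icc_rpow_neg {h : ℝ} (hh : 0 < h) {A B : ℕ} (hA : 1 ≤ A) (hAB : A ≤ B)
    (hle : h ≤ (A : ℝ) ^ (-h) - (B : ℝ) ^ (-h)) :
    1 ≤ ∑ a ∈ Finset.Icc A B, (a : ℝ) ^ (-(1 + h)) := by
  have key : ∀ n : ℕ, (A : ℝ) ^ (-h) - ((A + n : ℕ) : ℝ) ^ (-h) ≤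
      h * ∑ a ∈ Finset.Ico A (A + n), (a : ℝ) ^ (-(1 + h)) := by
    intro n
    induction n with
    | zero => simp
    | succ n ih =>
      have hpos : (0 : ℝ) < (A + n : ℕ) := by positivity
      rw [← add_assoc, Finset.sum_Ico_succ_top (by omega), mul_add]
      have h1 := rpow_neg_sub_rpow_neg_ge (u := ((A + n + 1 : ℕ) : ℝ)) (by positivity) hpos hh.le
      rw [show ((A + n : ℕ) : ℝ) - ((A + n + 1 : ℕ) : ℝ) = -1 by push_cast; ring] at h1
      linarith
  have h1 := key (B - A)
  rw [Nat.add_sub_cancel' hAB] at h1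
  have h2 : ∑ a ∈ Finset.Ico A B, (a : ℝ) ^ (-(1 + h)) ≤
      ∑ a ∈ Finset.Icc A B, (a : ℝ) ^ (-(1 + h)) :=
    Finset.sum_le_sum_of_subset_of_nonneg Finset.Ico_subset_Icc_self fun _ _ _ => by positivity
  have h3 : h * 1 ≤ h * ∑ a ∈ Finset.Ico A B, (a : ℝ) ^ (-(1 + h)) := by linarith
  linarith [le_of_mul_le_mul_left h3 hh]

/-! ### Upper bound for the dimension by coverings with pairs of digits -/

theorem ENNReal.tsum_fin_pi_prod {α : Type*} (g : α → ℝ≥0∞) (k : ℕ) :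
    ∑' w : Fin k → α, ∏ j, g (w j) = (∑' a, g a) ^ k := by
  induction k with
  | zero => simp
  | succ k ih =>
    rw [← (Fin.consEquiv fun _ : Fin (k + 1) => α).tsum_eq, ENNReal.tsum_prod', pow_succ', ← ih,
      ← ENNReal.tsum_mul_right]
    refine tsum_congr fun a => ?_
    rw [← ENNReal.tsum_mul_left]
    refine tsum_congr fun w => ?_
    simp [Fin.prod_univ_succ, Fin.consEquiv]

/-- For `t ≥ N` this is Bernoulli, `(1 + 1/N) ^ t ≥ t / N`; otherwise the left side is nonpositive.
It makes pairs with product far below `t` expensive. -/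
theorem mul_log_div_le {t κ N : ℝ} (ht : 1 ≤ t) (hκ : 0 ≤ κ) (hκ1 : κ ≤ 1) (hN : 0 < N) :
    κ * (Real.log t - Real.log N) ≤ t * (Real.log (N + 1) - Real.log N) := by
  have h0 : 0 ≤ Real.log (N + 1) - Real.log N :=
    sub_nonneg.2 (Real.log_le_log hN (by linarith))
  rcases le_total (Real.log t) (Real.log N) with h | h
  · nlinarith
  · have h1 := one_add_mul_self_le_rpow_one_add (s := 1 / N) (by
      have : 0 < 1 / N := by positivity
      linarith) ht
    have h2 : t / N ≤ (1 + 1 / N) ^ t := by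
      have : t * (1 / N) = t / N := by ring
      linarith
    have h3 := Real.log_le_log (by positivity) h2
    rw [Real.log_rpow (by positivity), Real.log_div (by linarith) hN.ne',
      show 1 + 1 / N = (N + 1) / N by field_simp, Real.log_div (by linarith) hN.ne'] at h3
    nlinarith

/-- Split the exponent `1 + η + ε t` as `(1 + η + t) - (1 - ε) t`: the first part is bounded by
`prod_pairs_le_contDen`, the second by the hypothesis on the product, and `mul_log_div_le` treats
each pair. -/
theorem rpow_contDen_le_prod {d : ℕ → ℕ} (hd : ∀ n, 1 ≤ d n) {ε η t κ : ℝ} (hη : 0 ≤ η)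
    (ht : 1 ≤ t) (hκ : 0 ≤ κ) (hκ1 : κ ≤ 1) (k : ℕ)
    (h : (1 - ε) * Real.log (contDen d (2 * k + 1)) ≤
      Real.log (∏ i ∈ Finset.range (2 * k), (d i : ℝ))) :
    (contDen d (2 * k + 1) ^ 2) ^ (-((1 + η + ε * t) / 2)) ≤
      ∏ j ∈ Finset.range k, t ^ (-κ) *
        ((d (2 * j) : ℝ) ^ (-(1 + (η - κ))) * (d (2 * j + 1) : ℝ) ^ (-(1 + (η - κ)))) := by
  have hd0 : ∀ n, (0 : ℝ) < d n := fun n => by exact_mod_cast hd n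
  have hpairs : ∏ i ∈ Finset.range (2 * k), (d i : ℝ) =
      ∏ j ∈ Finset.range k, (d (2 * j) * d (2 * j + 1) : ℝ) := by
    clear h
    induction k with
    | zero => simp
    | succ k ih =>
      rw [show 2 * (k + 1) = 2 * k + 1 + 1 by ring, Finset.prod_range_succ,
        Finset.prod_range_succ, ih, Finset.prod_range_succ, mul_assoc]
  rw [hpairs, Real.log_prod fun j _ => (mul_pos (hd0 _) (hd0 _)).ne'] at h
  have hq := (one_le_contDen hd (2 * k)).1
  have h1 := Real.log_le_log (Finset.prod_pos fun j _ => by positivity)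
    (prod_pairs_le_contDen (d := d) k)
  rw [Real.log_prod fun j _ => by positivity] at h1
  have h2 : ∏ j ∈ Finset.range k, t ^ (-κ) *
      ((d (2 * j) : ℝ) ^ (-(1 + (η - κ))) * (d (2 * j + 1) : ℝ) ^ (-(1 + (η - κ)))) =
      Real.exp (∑ j ∈ Finset.range k, (-κ * Real.log t -
        (1 + (η - κ)) * Real.log (d (2 * j) * d (2 * j + 1)))) := by
    rw [Real.exp_sum]
    refine Finset.prod_congr rfl fun j _ => ?_
    rw [Real.log_mul (hd0 _).ne' (hd0 _).ne', Real.rpow_def_of_pos (by linarith),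
      Real.rpow_def_of_pos (hd0 _), Real.rpow_def_of_pos (hd0 _), ← Real.exp_add, ← Real.exp_add]
    congr 1
    ring
  rw [h2, Real.rpow_def_of_pos (by positivity), Real.exp_le_exp, Real.log_pow]
  have h3 : ∑ j ∈ Finset.range k, (t * Real.log (d (2 * j) * d (2 * j + 1)) -
        (1 + η + t) * Real.log (d (2 * j) * d (2 * j + 1) + 1)) ≤
      ∑ j ∈ Finset.range k, (-κ * Real.log t -
        (1 + (η - κ)) * Real.log (d (2 * j) * d (2 * j + 1))) := by
    refine Finset.sum_le_sum fun j _ => ?_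
    have hN : (0 : ℝ) < d (2 * j) * d (2 * j + 1) := mul_pos (hd0 _) (hd0 _)
    have h4 := mul_log_div_le ht hκ hκ1 hN
    have h5 := Real.log_le_log hN (le_add_of_nonneg_right zero_le_one)
    nlinarith
  refine le_trans ?_ h3
  rw [Finset.sum_sub_distrib, ← Finset.mul_sum, ← Finset.mul_sum]
  have h6 := mul_le_mul_of_nonneg_left h1 (by linarith : 0 ≤ 1 + η + t)
  have h7 := mul_le_mul_of_nonneg_left h (by linarith : 0 ≤ t)
  push_cast
  nlinarith

/-- The irrationals whose products of digits dominate `q_n ^ (1 - ε)` from the index `N` on. -/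
def largeProductSet (ε : ℝ) (N : ℕ) : Set ℝ :=
  {x | x ∈ unitIrrationals ∧ ∀ n ≥ N,
    (1 - ε) * Real.log (cfDenom x n) ≤ Real.log (∏ i ∈ Finset.range n, cfDigit x i)}

/-- The condition on `t ^ κ` makes the weights of all pairs sum to at most `1`, so the coverings by
cylinders of order `2k` keep the Hausdorff measure at most `1`. -/
theorem dimH_largeProductSet_le {ε η t κ : ℝ} (hε : 0 ≤ ε) (ht : 1 ≤ t) (hκ : 0 ≤ κ)
    (hκ1 : κ ≤ 1) (hκη : κ < η) (hle : (1 + 1 / (η - κ)) ^ 2 ≤ t ^ κ) (N : ℕ) :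
    dimH (largeProductSet ε N) ≤ ENNReal.ofReal ((1 + η + ε * t) / 2) := by
  set s := (1 + η + ε * t) / 2 with hs
  have hs0 : 0 < s := by
    have : 0 ≤ ε * t := by positivity
    rw [hs]
    linarith
  let g : ℕ × ℕ → ℝ≥0∞ := fun p => ENNReal.ofReal (t ^ (-κ) *
    ((p.1 : ℝ) ^ (-(1 + (η - κ))) * (p.2 : ℝ) ^ (-(1 + (η - κ)))))
  have hg : ∑' p, g p ≤ 1 := by
    have h1 : ∀ a b : ℕ, g (a, b) = ENNReal.ofReal (t ^ (-κ)) *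
        (ENNReal.ofReal ((a : ℝ) ^ (-(1 + (η - κ)))) *
          ENNReal.ofReal ((b : ℝ) ^ (-(1 + (η - κ))))) := by
      intro a b
      simp only [g]
      rw [ENNReal.ofReal_mul (by positivity), ENNReal.ofReal_mul (by positivity)]
    rw [ENNReal.tsum_prod']
    simp only [h1, ENNReal.tsum_mul_left, ENNReal.tsum_mul_right]
    have h2 := tsum_rpow_neg_le (sub_pos.2 hκη)
    refine (mul_le_mul_right (mul_le_mul' h2 h2) _).trans ?_
    have h3 : 0 ≤ 1 + 1 / (η - κ) := by
      have := sub_pos.2 hκη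
      positivity
    rw [← ENNReal.ofReal_mul h3, ← ENNReal.ofReal_mul (by positivity), ENNReal.ofReal_le_one,
      Real.rpow_neg (by linarith), inv_mul_le_iff₀ (by positivity)]
    linarith
  let T : ∀ k : ℕ, (Fin k → ℕ × ℕ) → Set ℝ := fun k w => {x | x ∈ largeProductSet ε N ∧
    ∃ d y, IsExpansion x d y ∧ ∀ j : Fin k, d (2 * j) = (w j).1 ∧ d (2 * j + 1) = (w j).2}
  have hdiam : ∀ k w, ∀ x ∈ T k w, ∀ d y, IsExpansion x d y →
      (∀ j : Fin k, d (2 * j) = (w j).1 ∧ d (2 * j + 1) = (w j).2) →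
      Metric.ediam (T k w) ≤ ENNReal.ofReal ((contDen d (2 * k + 1) ^ 2)⁻¹) := by
    intro k w x _ d y hx hdw
    refine Metric.ediam_le fun a ha b hb => ?_
    obtain ⟨-, da, ya, hxa, hda⟩ := ha
    obtain ⟨-, db, yb, hxb, hdb⟩ := hb
    have hagree : ∀ d' : ℕ → ℕ, (∀ j : Fin k, d' (2 * j) = (w j).1 ∧ d' (2 * j + 1) = (w j).2) →
        ∀ i < 2 * k, d i = d' i := by
      intro d' hd' i hi
      rcases Nat.even_or_odd' i with ⟨j, rfl | rfl⟩
      · exact (hdw ⟨j, by omega⟩).1.trans (hd' ⟨j, by omega⟩).1.symm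
      · exact (hdw ⟨j, by omega⟩).2.trans (hd' ⟨j, by omega⟩).2.symm
    have hab : ∀ i < 2 * k, da i = db i := fun i hi =>
      (hagree da hda i hi).symm.trans (hagree db hdb i hi)
    have hle := hxa.abs_sub_le hxb hab
    rw [← contDen_congr (hagree da hda) _ le_rfl] at hle
    have hq := (one_le_contDen hx.one_le (2 * k)).1
    rw [edist_dist, Real.dist_eq]
    refine ENNReal.ofReal_le_ofReal ?_
    rwa [← one_div, le_div_iff₀ (by positivity)]
  have hterm : ∀ k w, N ≤ 2 * k → Metric.ediam (T k w) ^ s ≤ ∏ j, g (w j) := by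
    intro k w hk
    rcases (T k w).eq_empty_or_nonempty with h0 | ⟨x, hx⟩
    · rw [h0, Metric.ediam_empty, ENNReal.zero_rpow_of_pos hs0]
      exact zero_le
    obtain ⟨hxN, d, y, hd, hdw⟩ := id hx
    have hq := (one_le_contDen hd.one_le (2 * k)).1
    have hlog := hxN.2 (2 * k) hk
    simp only [hd.cfDigit_eq, hd.cfDenom_eq] at hlog
    calc Metric.ediam (T k w) ^ s
        ≤ ENNReal.ofReal ((contDen d (2 * k + 1) ^ 2)⁻¹) ^ s := by
          gcongr
          exact hdiam k w x hx d y hd hdw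
      _ = ENNReal.ofReal ((contDen d (2 * k + 1) ^ 2) ^ (-s)) := by
          rw [ENNReal.ofReal_rpow_of_nonneg (by positivity) hs0.le,
            Real.inv_rpow (by positivity), Real.rpow_neg (by positivity)]
      _ ≤ ENNReal.ofReal (∏ j ∈ Finset.range k, t ^ (-κ) *
            ((d (2 * j) : ℝ) ^ (-(1 + (η - κ))) * (d (2 * j + 1) : ℝ) ^ (-(1 + (η - κ))))) :=
          ENNReal.ofReal_le_ofReal
            (rpow_contDen_le_prod hd.one_le (hκ.trans hκη.le) ht hκ hκ1 k hlog)
      _ = ∏ j, g (w j) := by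
          rw [ENNReal.ofReal_prod_of_nonneg fun j _ => by positivity, Finset.prod_range]
          refine Finset.prod_congr rfl fun j _ => ?_
          rw [(hdw j).1, (hdw j).2]
  have hr : Tendsto (fun k : ℕ => ENNReal.ofReal ((1 / 4 : ℝ) ^ k)) atTop (𝓝 0) := by
    rw [← ENNReal.ofReal_zero]
    exact ENNReal.tendsto_ofReal (tendsto_pow_atTop_nhds_zero_of_lt_one (by norm_num) (by norm_num))
  have hmeas : μH[s] (largeProductSet ε N) ≤ 1 := by
    refine (Measure.hausdorffMeasure_le_liminf_tsum s _ _ hr T ?_ ?_).trans ?_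
    · refine Eventually.of_forall fun k w => ?_
      rcases (T k w).eq_empty_or_nonempty with h0 | ⟨x, hx⟩
      · rw [h0, Metric.ediam_empty]
        exact zero_le
      obtain ⟨-, d, y, hd, hdw⟩ := id hx
      refine (hdiam k w x hx d y hd hdw).trans (ENNReal.ofReal_le_ofReal ?_)
      rw [one_div, inv_pow]
      refine inv_anti₀ (by positivity) ?_
      calc (4 : ℝ) ^ k = (2 ^ k) ^ 2 := by rw [← pow_mul, mul_comm, pow_mul]; norm_num
        _ ≤ _ := by
          gcongr
          exact two_pow_le_contDen hd.one_le k
    · refine Eventually.of_forall fun k x hx => ?_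
      obtain ⟨d, y, hd⟩ := exists_isExpansion hx.1
      exact Set.mem_iUnion.2
        ⟨fun j => (d (2 * j), d (2 * j + 1)), hx, d, y, hd, fun j => ⟨rfl, rfl⟩⟩
    · calc _ ≤ liminf (fun _ : ℕ => (1 : ℝ≥0∞)) atTop := by
            refine liminf_le_liminf ?_
            filter_upwards [eventually_ge_atTop N] with k hk
            calc _ ≤ ∑' w : Fin k → ℕ × ℕ, ∏ j, g (w j) :=
                  ENNReal.tsum_le_tsum fun w => hterm k w (by omega)
              _ = (∑' p, g p) ^ k := ENNReal.tsum_fin_pi_prod g k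
              _ ≤ 1 := pow_le_one' hg k
        _ = 1 := liminf_const _
  rw [ENNReal.ofReal]
  apply dimH_le_of_hausdorffMeasure_ne_top
  rw [Real.coe_toNNReal _ hs0.le]
  exact (hmeas.trans_lt ENNReal.one_lt_top).ne

theorem scalingLevelSet_subset_iUnion {α β : ℝ} (hβ : 0 ≤ β) (hαβ : β < α) :
    scalingLevelSet α ⊆ ⋃ N, largeProductSet (1 - β) N := by
  intro x hx
  obtain ⟨d, y, hd⟩ := exists_isExpansion hx.1
  obtain ⟨N, hN⟩ := eventually_atTop.1 (hx.2.eventually_const_lt hαβ)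
  refine Set.mem_iUnion.2 ⟨N, hx.1, fun n hn => ?_⟩
  have h1 := hN n hn
  have h2 : 0 ≤ Real.log (cfDenom x n) := by
    rw [hd.cfDenom_eq]
    exact Real.log_nonneg (one_le_contDen hd.one_le n).1
  -- If `log q_n = 0`, the quotient is `0` by convention and cannot exceed `β ≥ 0`.
  rcases h2.eq_or_lt with h3 | h3
  · rw [← h3, div_zero] at h1
    linarith
  · rw [lt_div_iff₀ h3] at h1
    linarith

theorem dimH_scalingLevelSet_le {α β η t κ : ℝ} (hβ : 0 ≤ β) (hβ1 : β ≤ 1) (hαβ : β < α)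
    (ht : 1 ≤ t) (hκ : 0 ≤ κ) (hκ1 : κ ≤ 1) (hκη : κ < η)
    (hle : (1 + 1 / (η - κ)) ^ 2 ≤ t ^ κ) :
    dimH (scalingLevelSet α) ≤ ENNReal.ofReal ((1 + η + (1 - β) * t) / 2) := by
  refine (dimH_mono (scalingLevelSet_subset_iUnion hβ hαβ)).trans ?_
  rw [dimH_iUnion]
  exact iSup_le fun N =>
    dimH_largeProductSet_le (by linarith) ht hκ hκ1 hκη hle N

/-! ### Choice of parameters and asymptotics -/

theorem tendsto_log_div_rpow {r : ℝ} (hr : 0 < r) :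
    Tendsto (fun D : ℝ => Real.log D / D ^ r) atTop (𝓝 0) :=
  (isLittleO_log_rpow_atTop hr).tendsto_div_nhds_zero

theorem tendsto_log_div_self : Tendsto (fun D : ℝ => Real.log D / D) atTop (𝓝 0) := by
  simpa using tendsto_log_div_rpow one_pos

theorem tendsto_mul_exp_neg_mul {a : ℝ} (ha : 0 < a) :
    Tendsto (fun D : ℝ => D * Real.exp (-(a * D))) atTop (𝓝 0) := by
  have h1 := (Real.tendsto_pow_mul_exp_neg_atTop_nhds_zero 1).comp
    (tendsto_id.const_mul_atTop ha)
  have h2 := h1.const_mul a⁻¹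
  rw [mul_zero] at h2
  refine h2.congr fun D => ?_
  simp only [Function.comp_apply, id, pow_one]
  field_simp

theorem eventually_dimH_scalingLevelSet_le :
    ∀ᶠ D : ℝ in atTop, dimH (scalingLevelSet (1 - Real.exp (-D))) ≤
      ENNReal.ofReal (1 / 2 + 2 * (Real.log D / D)) := by
  filter_upwards [eventually_gt_atTop 2, Real.tendsto_log_atTop.eventually_ge_atTop 10,
    tendsto_log_div_self.eventually_le_const (by norm_num : (0 : ℝ) < 1 / 3),
    (tendsto_mul_exp_neg_mul (by norm_num : (0 : ℝ) < 1 / 10)).eventually_le_const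
      (by norm_num : (0 : ℝ) < 1)] with D hD hlog hsmall hexp
  have hδ : Real.exp (-D) ≤ 1 / 2 := by
    rw [Real.exp_neg]
    have := Real.add_one_le_exp D
    rw [inv_le_comm₀ (Real.exp_pos _) (by norm_num)]
    linarith
  have hδ0 := Real.exp_pos (-D)
  have hL : 0 < Real.log D / D := by positivity
  -- Write `L = log D / D`. Here `t ^ κ = D ^ 2.43` beats `(1 + 1/(η - κ)) ^ 2 ≤ D ^ 2`, and `ε t =
  -- 2 exp (-D/10)` is at most `L / 5`, so `η + ε t ≤ 4 L` with room to spare. The factor `2` in `β`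
  -- secures `β < α`.
  refine (dimH_scalingLevelSet_le (β := 1 - 2 * Real.exp (-D)) (t := Real.exp (9 / 10 * D))
    (η := 3 * (Real.log D / D)) (κ := 27 / 10 * (Real.log D / D)) (by linarith) (by linarith)
    (by linarith) (Real.one_le_exp (by linarith)) (by linarith) (by linarith) (by linarith)
    ?_).trans (ENNReal.ofReal_le_ofReal ?_)
  · have h1 : 1 / (3 * (Real.log D / D) - 27 / 10 * (Real.log D / D)) ≤ D / 3 := by
      rw [show 3 * (Real.log D / D) - 27 / 10 * (Real.log D / D) = 3 / 10 * (Real.log D / D) by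
        ring, div_le_iff₀ (by positivity)]
      have : D / 3 * (3 / 10 * (Real.log D / D)) = Real.log D / 10 := by
        field_simp
      linarith
    have h0 : 0 ≤ 1 / (3 * (Real.log D / D) - 27 / 10 * (Real.log D / D)) :=
      one_div_nonneg.2 (by linarith)
    have h2 : Real.exp (9 / 10 * D) ^ (27 / 10 * (Real.log D / D)) =
        Real.exp (243 / 100 * Real.log D) := by
      rw [← Real.exp_mul]
      congr 1
      field_simp
      norm_num
    rw [h2]
    calc _ ≤ D ^ 2 := by
          refine pow_le_pow_left₀ (by linarith) ?_ 2
          linarith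
      _ = Real.exp (2 * Real.log D) := by
          rw [two_mul, Real.exp_add, Real.exp_log (by linarith), sq]
      _ ≤ _ := Real.exp_le_exp.2 (by linarith)
  · have h1 : Real.exp (-D) * Real.exp (9 / 10 * D) = Real.exp (-(1 / 10 * D)) := by
      rw [← Real.exp_add]
      congr 1
      ring
    have h2 : Real.exp (-(1 / 10 * D)) ≤ 1 / 10 * (Real.log D / D) := by
      have h3 : 1 / 10 * (Real.log D / D) = Real.log D / 10 / D := by ring
      rw [h3, le_div_iff₀ (by linarith)]
      linarith
    nlinarith

theorem eventually_le_dimH_scalingLevelSet {c : ℝ} (hc0 : 0 < c) (hc1 : c < 1) :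
    ∀ᶠ D : ℝ in atTop, ENNReal.ofReal (1 / 2 + c * (Real.log D / D)) ≤
      dimH (scalingLevelSet (1 - Real.exp (-D))) := by
  -- The gap `b - c` absorbs the loss from the factor `1 - δ`; `b < 1` makes `log D / D` negligible
  -- against `D ^ (-b)`.
  obtain ⟨b, hcb, hb1⟩ := exists_between hc1
  have hb0 : 0 < b := hc0.trans hcb
  filter_upwards [eventually_gt_atTop 2, Real.tendsto_log_atTop.eventually_ge_atTop 1,
    tendsto_log_div_self.eventually_le_const (by norm_num : (0 : ℝ) < 1 / 2),
    (tendsto_mul_exp_neg_mul one_pos).eventually_le_const (sub_pos.2 hcb),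
    (tendsto_rpow_neg_atTop hb0).eventually_le_const (by norm_num : (0 : ℝ) < 1 / 2),
    (tendsto_log_div_rpow (sub_pos.2 hb1)).eventually_le_const
      (by norm_num : (0 : ℝ) < 1 / 12)] with D hD hlog hsmall hexp hpow hlogpow
  have hD0 : 0 < D := by linarith
  have hL : 0 < Real.log D / D := by positivity
  -- This `A` makes `δ A ^ 2 ≥ 1`, as steering requires, and `A ^ (-η)` comparable to `D ^ (-b)`.
  set A := ⌈Real.exp (D / 2)⌉₊ with hAdef
  set η := 2 * b * (Real.log D / D) with hη
  have hη0 : 0 < η := by positivity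
  have hη1 : η ≤ 1 := by
    rw [hη]
    nlinarith
  have hAle : Real.exp (D / 2) ≤ A := Nat.le_ceil _
  have hAge : (A : ℝ) ≤ Real.exp (D / 2 + 1) := by
    have h1 := (Nat.ceil_lt_add_one (Real.exp_pos (D / 2)).le).le
    have h2 := Real.one_le_exp (by linarith : 0 ≤ D / 2)
    have h3 := Real.add_one_le_exp (1 : ℝ)
    rw [Real.exp_add]
    nlinarith
  have hApos : (0 : ℝ) < A := (Real.exp_pos _).trans_le hAle
  have hA1 : 1 ≤ A := by exact_mod_cast hApos
  have hlA : D / 2 ≤ Real.log A := (Real.le_log_iff_exp_le hApos).2 hAle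
  have hlA' : Real.log A ≤ D / 2 + 1 := (Real.log_le_iff_le_exp hApos).2 hAge
  have hηD : η * D = 2 * b * Real.log D := by
    rw [hη]
    field_simp
  have hup : (A : ℝ) ^ (-η) ≤ D ^ (-b) := by
    rw [Real.rpow_def_of_pos hApos, Real.rpow_def_of_pos hD0, Real.exp_le_exp]
    nlinarith
  have hlow : D ^ (-b) * (1 / 3) ≤ (A : ℝ) ^ (-η) := by
    have h3 : (1 / 3 : ℝ) ≤ Real.exp (-1) := by
      rw [Real.exp_neg, one_div]
      exact inv_anti₀ (Real.exp_pos _) Real.exp_one_lt_three.le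
    calc D ^ (-b) * (1 / 3) ≤ D ^ (-b) * Real.exp (-1) := by gcongr
      _ ≤ _ := by
        rw [Real.rpow_def_of_pos hApos, Real.rpow_def_of_pos hD0, ← Real.exp_add, Real.exp_le_exp]
        nlinarith
  -- With `B = A ^ 2`, the telescoped difference is `A ^ (-η) (1 - A ^ (-η)) ≥ D ^ (-b) / 3 * (1 /
  -- 2)`, which is at least `η`.
  have hsum : 1 ≤ ∑ a ∈ Finset.Icc A (A ^ 2), (a : ℝ) ^ (-(1 + η)) := by
    refine one_le_sum_Icc_rpow_neg hη0 hA1 (Nat.le_self_pow two_ne_zero A) ?_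
    have h1 : ((A ^ 2 : ℕ) : ℝ) ^ (-η) = (A : ℝ) ^ (-η) * (A : ℝ) ^ (-η) := by
      rw [Nat.cast_pow, sq, Real.mul_rpow hApos.le hApos.le]
    have h2 : η ≤ D ^ (-b) * (1 / 6) := by
      rw [div_le_iff₀ (by positivity), Real.rpow_sub hD0, Real.rpow_one] at hlogpow
      have h3 : Real.log D / D ≤ 1 / 12 * D ^ (-b) := by
        rw [div_le_iff₀ hD0, Real.rpow_neg hD0.le]
        calc _ ≤ _ := hlogpow
          _ = _ := by ring
      rw [hη]
      nlinarith
    have h4 : 0 < (A : ℝ) ^ (-η) := by positivity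
    rw [h1]
    nlinarith
  refine le_trans (ENNReal.ofReal_le_ofReal ?_) (le_dimH_scalingLevelSet (Real.exp_pos (-D)).le
    (by rw [← Real.exp_zero, Real.exp_lt_exp]; linarith) hη0.le hA1 ?_ hsum)
  · rw [one_mul] at hexp
    have h1 : Real.exp (-D) ≤ (b - c) * (Real.log D / D) := by
      rw [← mul_div_assoc, le_div_iff₀ hD0]
      nlinarith
    have h2 := Real.exp_pos (-D)
    have h3 : Real.exp (-D) * (1 + η) ≤ Real.exp (-D) * 2 := by gcongr; linarith
    rw [hη] at h3 ⊢
    linarith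
  · have h1 : Real.exp D ≤ (A : ℝ) ^ 2 := by
      calc Real.exp D = Real.exp (D / 2) ^ 2 := by
            rw [sq, ← Real.exp_add]
            congr 1
            ring
        _ ≤ _ := by gcongr
    calc (1 : ℝ) = Real.exp (-D) * 1 * Real.exp D := by
          rw [mul_one, ← Real.exp_add, neg_add_cancel, Real.exp_zero]
      _ ≤ _ := by
        gcongr
        linarith

theorem eventually_scalingSpectrum_bounds {c₁ c₂ : ℝ} (h0 : 0 < c₁) (h1 : c₁ < 1) (h2 : 2 ≤ c₂) :
    ∀ᶠ α in 𝓝[<] (1 : ℝ), c₁ * logLogRatio α ≤ scalingSpectrum α - 1 / 2 ∧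
      scalingSpectrum α - 1 / 2 ≤ c₂ * logLogRatio α := by
  have hsub : Tendsto (fun α : ℝ => 1 - α) (𝓝[<] 1) (𝓝[>] 0) := by
    refine tendsto_nhdsWithin_iff.2 ⟨?_, ?_⟩
    · have : Tendsto (fun α : ℝ => 1 - α) (𝓝 1) (𝓝 (1 - 1)) := by
        exact (continuous_const.sub continuous_id).tendsto 1
      rw [sub_self] at this
      exact this.mono_left nhdsWithin_le_nhds
    · filter_upwards [self_mem_nhdsWithin] with α hα
      exact Set.mem_Ioi.2 (sub_pos.2 (Set.mem_Iio.1 hα))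
  have hD : Tendsto (fun α : ℝ => Real.log (1 / (1 - α))) (𝓝[<] 1) atTop := by
    simp only [one_div]
    exact Real.tendsto_log_atTop.comp (tendsto_inv_nhdsGT_zero.comp hsub)
  filter_upwards [hD.eventually (eventually_le_dimH_scalingLevelSet h0 h1),
    hD.eventually eventually_dimH_scalingLevelSet_le, hD.eventually_ge_atTop 1,
    self_mem_nhdsWithin] with α hlow hup hone hα
  have hα' : 0 < 1 - α := sub_pos.2 (Set.mem_Iio.1 hα)
  have hexp : 1 - Real.exp (-Real.log (1 / (1 - α))) = α := by
    rw [one_div, Real.log_inv, neg_neg, Real.exp_log hα']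
    ring
  rw [hexp] at hlow hup
  change ENNReal.ofReal (1 / 2 + c₁ * logLogRatio α) ≤ _ at hlow
  change _ ≤ ENNReal.ofReal (1 / 2 + 2 * logLogRatio α) at hup
  have hL : 0 ≤ logLogRatio α := div_nonneg (Real.log_nonneg hone) (by linarith)
  have hlow' := ENNReal.toReal_mono (Real.dimH_ne_top _) hlow
  have hup' := ENNReal.toReal_mono ENNReal.ofReal_ne_top hup
  rw [ENNReal.toReal_ofReal (by positivity)] at hlow' hup'
  have h3 : 2 * logLogRatio α ≤ c₂ * logLogRatio α := by gcongr
  rw [scalingSpectrum]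
  constructor <;> linarith

theorem theorem2 :
    (∃ c₁ c₂ : ℝ, 0 < c₁ ∧ c₁ ≤ c₂ ∧ ∀ᶠ α in 𝓝[<] (1 : ℝ),
      c₁ * logLogRatio α ≤ scalingSpectrum α - 1 / 2 ∧
        scalingSpectrum α - 1 / 2 ≤ c₂ * logLogRatio α) ∧
    (∀ c₁ c₂ : ℝ, 0 < c₁ → c₁ < 1 → 2 < c₂ → ∀ᶠ α in 𝓝[<] (1 : ℝ),
      c₁ * logLogRatio α ≤ scalingSpectrum α - 1 / 2 ∧
        scalingSpectrum α - 1 / 2 ≤ c₂ * logLogRatio α) :=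
  ⟨⟨1 / 2, 2, by norm_num, by norm_num,
    eventually_scalingSpectrum_bounds (by norm_num) (by norm_num) le_rfl⟩,
    fun _ _ h0 h1 h2 => eventually_scalingSpectrum_bounds h0 h1 h2.le⟩
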